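/- Let $G=(V,E)$ be a finite directed graph with $V=\{v_1,\dots,v_n\}$. Say that $u$ dominates $v$ if there is a (possibly trivial) directed path from $u$ to $v$; the closure $\langle X\rangle_G$ of $X\subseteq V$ is the set of all vertices dominated by elements of $X$. For $x\in\mathbb F_2^n$ put $w_G(x)=|\langle \mathrm{supp}(x)\rangle_G|$ and $d_G(x,y)=w_G(y-x)$, where $\mathrm{supp}(x)=\{v_i : x_i\neq 0\}$. Let $V'$ be the set of strongly connected components of $G$, let $\pi:V\to V'$ be the projection, and let $L'(a)=|\pi^{-1}(a)|$ for $a\in V'$. Let $P_G=(V',\preceq)$ be the poset in which $a\preceq b$ if the vertices of $b$ dominate those of $a$. The height of $a\in V'$ is the maximal cardinality of a chain in $P_G$ with greatest element $a$; $V'_i$ is the set of elements of $V'$ of height $i$, $V_i=\pi^{-1}(V'_i)$, and $h_G$ is the maximal height. The poset $P_G$ is called hierarchical if $b\preceq a$ whenever $i>1$, $a\in V'_i$ and $b\in V'_{i-1}$. - $G$ satisfies the Unique Decomposition Property (UDP) if, for every $i$ and all $S,S'\subseteq V'_i$ with $\sum_{a\in S}L'(a)=\sum_{b\in S'}L'(b)$,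 there is a bijection $g:S\to S'$ with $L'(a)=L'(g(a))$ for all $a\in S$. - A finite directed graph satisfies Condition $\Omega$ if, for every integer $k>1$, it has at most two strongly connected components with exactly $k$ vertices. - $(\mathbb F_2^n,d_G)$ satisfies the MacWilliams Extension Property if, for all linear codes $\mathcal C,\mathcal C'\subseteq\mathbb F_2^n$ and every linear map $t:\mathcal C\to\mathcal C'$ with $w_G(t(c))=w_G(c)$ for all $c\in\mathcal C$, there is a bijective linear map $T:\mathbb F_2^n\to\mathbb F_2^n$ with $d_G(T(x),T(y))=d_G(x,y)$ for all $x,y$ and $T|_{\mathcal C}=t$. Theorem. Suppose that $P_G$ is a hierarchical poset. Then $(\mathbb F_2^n,d_G)$ satisfies the MacWilliams Extension Property if and only if $G$ satisfies the UDP and, for each $1\le i\le h_G$, the graph $\Gamma(V_i)$ induced by $G$ on $V_i$ satisfies Condition $\Omega$. -/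

import Mathlib

namespace Digraph

variable {V : Type*} (G : Digraph V)

/-- `u` dominates `v`: there is a directed trail (possibly of length zero) from `u` to `v`.
Any directed walk can be shortened to a trail, so this is reachability along edges. Loops have no
influence on this relation. -/
def Dominates (u v : V) : Prop := Relation.ReflTransGen G.Adj u v

/-- `X` is closed: it contains every vertex dominated by one of its elements. -/
def IsClosedSet (X : Set V) : Prop := ∀ u ∈ X, ∀ v, G.Dominates u v → v ∈ X

/-- The closure `⟨X⟩_G`: the smallest closed set containing `X`. -/
def clo (X : Set V) : Set V := ⋂₀ {Y | G.IsClosedSet Y ∧ X ⊆ Y}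

theorem mem_clo {X : Set V} {v : V} : v ∈ G.clo X ↔ ∃ u ∈ X, G.Dominates u v := by
  constructor
  · intro h
    exact h {w | ∃ u ∈ X, G.Dominates u w}
      ⟨fun u ⟨a, ha, hau⟩ w huw => ⟨a, ha, Relation.ReflTransGen.trans hau huw⟩,
        fun u hu => ⟨u, hu, Relation.ReflTransGen.refl⟩⟩
  · rintro ⟨u, hu, huv⟩ Y ⟨hY, hXY⟩
    exact hY u (hXY hu) v huv

theorem mem_clo_singleton {u v : V} : v ∈ G.clo {u} ↔ G.Dominates u v := by
  simp [mem_clo]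

/-- The graph induced by `G` on a set of vertices. -/
def inducedOn (X : Set V) : Digraph X where
  Adj u v := G.Adj u v

/-! ### The reduced canonical form and its poset -/

/-- Two vertices are equivalent if they dominate each other; the classes are the strongly connected
components of `G`, that is, the maximal cliques of its expanded canonical form. -/
def sccSetoid : Setoid V where
  r u v := G.Dominates u v ∧ G.Dominates v u
  iseqv :=
    ⟨fun _ => ⟨.refl, .refl⟩, fun h => ⟨h.2, h.1⟩,
      fun h k => ⟨Relation.ReflTransGen.trans h.1 k.1, Relation.ReflTransGen.trans k.2 h.2⟩⟩

/-- The vertex set `V'` of the reduced canonical form, the underlying set of the poset `P_G`. -/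
def RedVert : Type _ := Quotient G.sccSetoid

/-- The projection `π : V → V'`. -/
def proj (v : V) : G.RedVert := Quotient.mk G.sccSetoid v

theorem proj_eq_iff {u v : V} : G.proj u = G.proj v ↔ G.Dominates u v ∧ G.Dominates v u :=
  Quotient.eq (r := G.sccSetoid)

/-- The weight `L'(a) = |π⁻¹(a)|`. -/
noncomputable def redWeight (a : G.RedVert) : ℕ := (G.proj ⁻¹' {a}).ncard

/-- The poset `P_G`: `a ≼ b` if some vertex of the component `a` lies in the closure of
some vertex of the component `b`. -/
instance : PartialOrder G.RedVert where
  le a b := ∃ u v, G.proj u = a ∧ G.proj v = b ∧ u ∈ G.clo {v}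
  le_refl a := by
    obtain ⟨u, rfl⟩ := Quotient.exists_rep a
    exact ⟨u, u, rfl, rfl, G.mem_clo_singleton.2 .refl⟩
  le_trans := by
    rintro a b c ⟨u, v, rfl, rfl, h⟩ ⟨v', w, h', rfl, k⟩
    rw [mem_clo_singleton] at h k
    exact ⟨u, w, rfl, rfl, G.mem_clo_singleton.2
      (Relation.ReflTransGen.trans (Relation.ReflTransGen.trans k (G.proj_eq_iff.1 h').1) h)⟩
  le_antisymm := by
    rintro a b ⟨u, v, rfl, rfl, h⟩ ⟨v', u', h₁, h₂, k⟩
    rw [mem_clo_singleton] at h k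
    exact G.proj_eq_iff.2 ⟨Relation.ReflTransGen.trans (G.proj_eq_iff.1 h₂).2
      (Relation.ReflTransGen.trans k (G.proj_eq_iff.1 h₁).1), h⟩

/-- The height of `a` in `P_G`: the maximal cardinality of a chain with greatest element `a`.
(`Order.height` counts the steps of such a chain, one less than its number of elements.) -/
noncomputable def redHeight (a : G.RedVert) : ℕ∞ := Order.height a + 1

/-- The number `h_G` of levels: the maximal height. -/
noncomputable def numLevels : ℕ∞ := ⨆ a : G.RedVert, G.redHeight a

/-- The `i`-th level `V'_i` of the reduced canonical form (nonempty only for `1 ≤ i ≤ h_G`). -/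
def redLevel (i : ℕ) : Set G.RedVert := {a | G.redHeight a = i}

/-- The `i`-th level `V_i = π⁻¹(V'_i)` of `G`. -/
def level (i : ℕ) : Set V := G.proj ⁻¹' G.redLevel i

/-- `P_G` is hierarchical: every element of a level lies above every element of the
level just below. -/
def IsHierarchical : Prop :=
  ∀ i : ℕ, 1 < i → ∀ a ∈ G.redLevel i, ∀ b ∈ G.redLevel (i - 1), b ≤ a

/-- The Unique Decomposition Property. -/
def UDP : Prop :=
  ∀ (i : ℕ) (S S' : Finset G.RedVert),
    (S : Set G.RedVert) ⊆ G.redLevel i → (S' : Set G.RedVert) ⊆ G.redLevel i →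
    ∑ a ∈ S, G.redWeight a = ∑ b ∈ S', G.redWeight b →
    ∃ g : S ≃ S', ∀ a : S, G.redWeight a = G.redWeight (g a)

/-- Condition `Ω`: for each `k > 1`, at most two vertices of the reduced canonical form have
weight `k`. -/
def ConditionOmega : Prop :=
  ∀ k : ℕ, 1 < k → {a : G.RedVert | G.redWeight a = k}.encard ≤ 2

/-! ### The graph metric on words indexed by the vertices -/

variable {F : Type*} [Field F]

/-- The `G`-weight `|⟨supp x⟩_G|` of a word. -/
noncomputable def wt (x : V → F) : ℕ := (G.clo (Function.support x)).ncard

/-- The `G`-distance. -/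
noncomputable def gdist (x y : V → F) : ℕ := G.wt (y - x)

variable (F)

/-- The group of linear isometries of the space of words with the `G`-distance. -/
def linIsom : Subgroup ((V → F) ≃ₗ[F] (V → F)) where
  carrier := {T | ∀ x y, G.gdist (T x) (T y) = G.gdist x y}
  one_mem' := fun _ _ => rfl
  mul_mem' := fun {S T} hS hT x y => (hS (T x) (T y)).trans (hT x y)
  inv_mem' := fun {T} hT x y => by
    have h := hT (T.symm x) (T.symm y)
    rw [T.apply_symm_apply, T.apply_symm_apply] at h
    exact h.symm

/-- The MacWilliams Extension Property: every weight-preserving linear map between linear codes is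
the restriction of a linear isometry of the whole space. -/
def MacWilliamsExtension : Prop :=
  ∀ (C C' : Submodule F (V → F)) (t : C →ₗ[F] C'),
    (∀ c : C, G.wt (t c : V → F) = G.wt (c : V → F)) →
    ∃ T ∈ G.linIsom F, ∀ c : C, T (c : V → F) = (t c : V → F)

end Digraph

/-! ### Words on a vertex set partitioned into blocks that are arranged in levels -/

/-! For a hierarchical poset, a word whose highest nonzero coordinate is on level `i` covers every
vertex below level `i`, and on level `i` exactly the blocks (strong components) that it meets. The
weight therefore determines both the level `i` and the total size of those blocks, and everything
reduces to words modulo lower levels.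

Necessity. A linear isometry permutes the blocks of each level and preserves their sizes, since
words meeting a single top block are indecomposable for the level weight. Extending the map between
the indicators of two unions of blocks of equal total size then yields the UDP
(`HasExtension.exists_equiv`). Three blocks of equal size `k > 1` on a level carry an isometry of
two-dimensional codes that does not respect the blocks, which forces Condition Ω
(`HasExtension.encard_le_two`).

Sufficiency. By the UDP, a weight-preserving `t` preserves the number of top blocks of each size.
For size one, independence of characters matches the coordinate functionals; for larger sizes Ω
leaves at most two kernels, matched by elementary facts on unions of subspaces (`exists_perm_hits`).
Matching kernels give block isomorphisms, hence a block-permuting isometry `S` that agrees with `t`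
modulo lower levels. With `P` a projection onto the code respecting the levels, `S + (t - S) ∘ P` is
the required extension (`exists_extension`). -/

namespace LeveledBlocks

variable {V B K : Type*} [Field K] (p : V → B) (l : B → ℕ)

/-- The weight of a word: the number of vertices that share a block with a vertex of the support,
or lie on a level strictly below one. -/
noncomputable def blockWt (x : V → K) : ℕ :=
  {v | ∃ u, x u ≠ 0 ∧ (p u = p v ∨ l (p v) < l (p u))}.ncard

variable (K) in
/-- The words supported on the levels below `i`. -/
def low (i : ℕ) : Submodule K (V → K) where
  carrier := {x | ∀ v, i ≤ l (p v) → x v = 0}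
  zero_mem' := fun _ _ => rfl
  add_mem' := fun {x y} hx hy v hv => by simp [hx v hv, hy v hv]
  smul_mem' := fun c x hx v hv => by simp [hx v hv]

/-- The blocks of level `i` that meet the support of a word. -/
def hits (i : ℕ) (x : V → K) : Set B := {a | l a = i ∧ ∃ v, p v = a ∧ x v ≠ 0}

/-- The number of vertices in the blocks of level `i` that meet the support of a word. -/
noncomputable def levelWt (i : ℕ) (x : V → K) : ℕ := (p ⁻¹' hits p l i x).ncard

variable {p l}

theorem low_mono : Monotone (low K p l) := fun _ _ hij _ hx v hv => hx v (hij.trans hv)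

theorem low_zero : low K p l 0 = ⊥ := by
  refine eq_bot_iff.2 fun x hx => ?_
  ext v
  exact hx v (Nat.zero_le _)

theorem exists_low_eq_top [Finite V] : ∃ n, low K p l n = ⊤ := by
  obtain ⟨n, hn⟩ := (Set.finite_range (l ∘ p)).bddAbove
  refine ⟨n + 1, eq_top_iff.2 fun x _ v hv => ?_⟩
  have := hn ⟨v, rfl⟩
  simp only [Function.comp] at this
  omega

theorem exists_mem_low_succ [Finite V] {x : V → K} (hx : x ≠ 0) :
    ∃ i, x ∈ low K p l (i + 1) ∧ x ∉ low K p l i := by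
  classical
  have h : ∃ n, x ∈ low K p l n := by
    obtain ⟨n, hn⟩ := exists_low_eq_top (K := K) (p := p) (l := l)
    exact ⟨n, hn ▸ Submodule.mem_top⟩
  have h0 : Nat.find h ≠ 0 := fun h0 => by
    have := Nat.find_spec h
    rw [h0, low_zero, Submodule.mem_bot] at this
    exact hx this
  obtain ⟨i, hi⟩ := Nat.exists_eq_succ_of_ne_zero h0
  exact ⟨i, by simpa [hi] using Nat.find_spec h, Nat.find_min h (by omega)⟩

theorem hits_eq_empty_iff {i : ℕ} {x : V → K} (hx : x ∈ low K p l (i + 1)) :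
    hits p l i x = ∅ ↔ x ∈ low K p l i := by
  constructor
  · intro h v hv
    rcases hv.lt_or_eq with hv | hv
    · exact hx v hv
    · by_contra hne
      exact (h ▸ (⟨hv.symm, v, rfl, hne⟩ : p v ∈ hits p l i x) : p v ∈ (∅ : Set B))
  · intro h
    refine Set.eq_empty_of_forall_notMem ?_
    rintro a ⟨ha, v, rfl, hv⟩
    exact hv (h v ha.ge)

theorem hits_add_subset (i : ℕ) (x y : V → K) :
    hits p l i (x + y) ⊆ hits p l i x ∪ hits p l i y := by
  rintro a ⟨ha, v, hv, hne⟩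
  by_cases hx : x v = 0
  · exact Or.inr ⟨ha, v, hv, fun hy => hne (by simp [hx, hy])⟩
  · exact Or.inl ⟨ha, v, hv, hx⟩

/-- A nonzero coordinate on level `i` or above covers all lower vertices and also itself, so it
pushes the weight strictly above the bound. Hence the weight alone detects the filtration `low`. -/
theorem blockWt_le_iff [Finite V] {i : ℕ} {x : V → K} :
    blockWt p l x ≤ {v | l (p v) < i}.ncard ↔ x ∈ low K p l i := by
  constructor
  · intro h v hv
    by_contra hne
    refine absurd h (not_le.2 (Set.ncard_lt_ncard ?_ (Set.toFinite _)))
    refine ⟨fun w hw => ⟨v, hne, Or.inr (lt_of_lt_of_le hw hv)⟩, fun hsub => ?_⟩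
    have hmem : v ∈ {w | l (p w) < i} := hsub ⟨v, hne, Or.inl rfl⟩
    exact absurd hmem (not_lt.2 hv)
  · intro h
    refine Set.ncard_le_ncard ?_ (Set.toFinite _)
    rintro v ⟨u, hu, huv⟩
    have : l (p u) < i := not_le.1 fun hle => hu (h u hle)
    rcases huv with huv | huv
    · simpa [← huv] using this
    · exact huv.trans this

theorem blockWt_eq [Finite V] {i : ℕ} {x : V → K} (hx : x ∈ low K p l (i + 1))
    (hx' : x ∉ low K p l i) :
    blockWt p l x = {v | l (p v) < i}.ncard + levelWt p l i x := by
  rw [blockWt, levelWt, ← Set.ncard_union_eq]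
  · congr 1
    ext v
    constructor
    · rintro ⟨u, hu, huv⟩
      have hlt : l (p u) < i + 1 := not_le.1 fun hle => hu (hx u hle)
      rcases huv with huv | huv
      · rcases (Nat.lt_succ_iff.1 hlt).lt_or_eq with h | h
        · exact Or.inl (by simpa [← huv] using h)
        · exact Or.inr ⟨huv ▸ h, u, huv, hu⟩
      · exact Or.inl (by simp only [Set.mem_ofPred_eq]; omega)
    · rintro (hv | ⟨-, u, hu, hne⟩)
      · rw [← hits_eq_empty_iff hx, ← ne_eq, ← Set.nonempty_iff_ne_empty] at hx'
        obtain ⟨a, ha, u, rfl, hu⟩ := hx'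
        exact ⟨u, hu, Or.inr (ha ▸ hv)⟩
      · exact ⟨u, hne, Or.inl hu⟩
  · rw [Set.disjoint_left]
    intro v hv hv'
    have h1 : l (p v) < i := hv
    exact h1.ne hv'.1

theorem blockWt_eq_zero_iff [Finite V] {x : V → K} : blockWt p l x = 0 ↔ x = 0 := by
  rw [← Submodule.mem_bot K (x := x), ← low_zero (p := p) (l := l), ← blockWt_le_iff]
  simp

theorem levelWt_eq_zero_iff [Finite V] {i : ℕ} {x : V → K} (hx : x ∈ low K p l (i + 1)) :
    levelWt p l i x = 0 ↔ x ∈ low K p l i := by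
  rw [levelWt, Set.ncard_eq_zero (Set.toFinite _), ← hits_eq_empty_iff hx]
  constructor
  · intro h
    refine Set.eq_empty_of_forall_notMem ?_
    rintro a ⟨ha, v, rfl, hv⟩
    have : v ∈ p ⁻¹' hits p l i x := ⟨ha, v, rfl, hv⟩
    rw [h] at this
    exact this
  · intro h
    rw [h, Set.preimage_empty]

theorem mem_low_iff_of_blockWt_eq [Finite V] {x y : V → K} (h : blockWt p l x = blockWt p l y)
    (i : ℕ) : x ∈ low K p l i ↔ y ∈ low K p l i := by
  rw [← blockWt_le_iff, ← blockWt_le_iff, h]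

theorem levelWt_eq_of_blockWt_eq [Finite V] {x y : V → K} (h : blockWt p l x = blockWt p l y)
    {i : ℕ} (hx : x ∈ low K p l (i + 1)) : levelWt p l i x = levelWt p l i y := by
  have hy := (mem_low_iff_of_blockWt_eq h _).1 hx
  by_cases hx' : x ∈ low K p l i
  · rw [(levelWt_eq_zero_iff hx).2 hx',
      (levelWt_eq_zero_iff hy).2 ((mem_low_iff_of_blockWt_eq h _).1 hx')]
  · have hy' := fun hy' => hx' ((mem_low_iff_of_blockWt_eq h i).2 hy')
    have := blockWt_eq hx hx'
    have := blockWt_eq hy hy'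
    omega

theorem blockWt_eq_of_levelWt_eq [Finite V] {i : ℕ} {x y : V → K} (hx : x ∈ low K p l (i + 1))
    (hx' : x ∉ low K p l i) (hy : y ∈ low K p l (i + 1))
    (h : levelWt p l i x = levelWt p l i y) : blockWt p l x = blockWt p l y := by
  have hy' : y ∉ low K p l i := by rwa [← levelWt_eq_zero_iff hy, ← h, levelWt_eq_zero_iff hx]
  rw [blockWt_eq hx hx', blockWt_eq hy hy', h]

/-! ### Linear isometries permute the blocks of each level -/

section Rigidity

variable {T : (V → K) ≃ₗ[K] (V → K)}

theorem blockWt_symm (hT : ∀ x, blockWt p l (T x) = blockWt p l x) (x : V → K) :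
    blockWt p l (T.symm x) = blockWt p l x := by
  rw [← hT, T.apply_symm_apply]

variable [Finite V]

/-- A decomposition of a word that meets just one block of level `i` into two words whose level
weights add up is trivial at level `i`. -/
theorem mem_low_or_mem_low_of_levelWt_add {i : ℕ} {x y z : V → K} {a : B}
    (hy : y ∈ low K p l (i + 1)) (hz : z ∈ low K p l (i + 1)) (hx : hits p l i x = {a})
    (hxyz : x = y + z) (hw : levelWt p l i y + levelWt p l i z = levelWt p l i x) :
    y ∈ low K p l i ∨ z ∈ low K p l i := by
  -- A summand that meets `a` already uses up the whole level weight of `x`, leaving zero for the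
  -- other one.
  have key : ∀ w : V → K, a ∈ hits p l i w → levelWt p l i x ≤ levelWt p l i w := fun w hw => by
    refine Set.ncard_le_ncard (Set.preimage_mono ?_) (Set.toFinite _)
    rw [hx]
    exact Set.singleton_subset_iff.2 hw
  have ha : a ∈ hits p l i y ∪ hits p l i z :=
    hits_add_subset i y z (hxyz ▸ hx ▸ Set.mem_singleton a)
  rw [← levelWt_eq_zero_iff hy, ← levelWt_eq_zero_iff hz]
  rcases ha with ha | ha
  · have := key y ha
    omega
  · have := key z ha
    omega

/-- Cut `T x` into its part `y` on one block `b` that it meets and the rest `z`. Level weights add,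
so pulling back by `T.symm` decomposes `x`, which has a single top block; one part must be trivial
on level `i`, and it is not `y`. -/
theorem exists_hits_eq_singleton (hT : ∀ x, blockWt p l (T x) = blockWt p l x) {i : ℕ}
    {x : V → K} (hx : x ∈ low K p l (i + 1)) {a : B} (ha : hits p l i x = {a}) :
    ∃ b, hits p l i (T x) = {b} := by
  classical
  have hTx := (mem_low_iff_of_blockWt_eq (hT x) _).2 hx
  have hne : hits p l i (T x) ≠ ∅ := by
    rw [Ne, hits_eq_empty_iff hTx, mem_low_iff_of_blockWt_eq (hT x), ← hits_eq_empty_iff hx, ha]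
    exact Set.singleton_ne_empty a
  obtain ⟨b, hb⟩ := Set.nonempty_iff_ne_empty.2 hne
  refine ⟨b, ?_⟩
  set y : V → K := fun v => if p v = b then T x v else 0 with hy
  set z : V → K := fun v => if p v = b then 0 else T x v with hz
  have hyz : T x = y + z := by
    ext v
    by_cases h : p v = b <;> simp [hy, hz, h]
  have hyl : y ∈ low K p l (i + 1) := fun v hv => by simp [hy, hTx v hv]
  have hzl : z ∈ low K p l (i + 1) := fun v hv => by simp [hz, hTx v hv]
  have hyh : hits p l i y = {b} := by
    ext c
    constructor
    · rintro ⟨-, v, rfl, hv⟩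
      by_contra hne
      exact hv (if_neg hne)
    · rintro rfl
      obtain ⟨hb, v, hv, hne⟩ := hb
      exact ⟨hb, v, hv, by simpa [hy, hv] using hne⟩
  have hzh : hits p l i z = hits p l i (T x) \ {b} := by
    ext c
    constructor
    · rintro ⟨hc, v, rfl, hv⟩
      have hvb : p v ≠ b := fun h => hv (by simp [hz, h])
      exact ⟨⟨hc, v, rfl, by simpa [hz, hvb] using hv⟩, hvb⟩
    · rintro ⟨⟨hc, v, rfl, hv⟩, hvb⟩
      have hvb : p v ≠ b := hvb
      exact ⟨hc, v, rfl, by simpa [hz, hvb] using hv⟩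
  have hw : levelWt p l i y + levelWt p l i z = levelWt p l i (T x) := by
    rw [levelWt, levelWt, levelWt, hyh, hzh, ← Set.ncard_union_eq, ← Set.preimage_union,
      Set.union_sdiff_self, Set.union_eq_self_of_subset_left (Set.singleton_subset_iff.2 hb)]
    · exact Disjoint.preimage _ Set.disjoint_sdiff_right
  have hsy := blockWt_symm hT y
  have hsz := blockWt_symm hT z
  have hyl' := (mem_low_iff_of_blockWt_eq hsy _).2 hyl
  have hzl' := (mem_low_iff_of_blockWt_eq hsz _).2 hzl
  have hdec := mem_low_or_mem_low_of_levelWt_add hyl' hzl' ha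
    (by rw [← map_add, ← hyz, T.symm_apply_apply])
    (by rw [levelWt_eq_of_blockWt_eq hsy hyl', levelWt_eq_of_blockWt_eq hsz hzl', hw,
      levelWt_eq_of_blockWt_eq (hT x) hTx])
  rw [mem_low_iff_of_blockWt_eq hsy, mem_low_iff_of_blockWt_eq hsz, ← hits_eq_empty_iff hyl,
    ← hits_eq_empty_iff hzl, hyh, hzh, Set.sdiff_eq_empty] at hdec
  rcases hdec with h | h
  · exact absurd h (Set.singleton_ne_empty b)
  · exact h.antisymm (Set.singleton_subset_iff.2 hb)

/-- If `b ≠ c`, nothing cancels on these blocks and `T (x + y)` meets both; but `x + y` meets at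
most the block `a`, so its image meets at most one. -/
theorem hits_map_eq_of_hits_eq_singleton (hT : ∀ x, blockWt p l (T x) = blockWt p l x) {i : ℕ}
    {x y : V → K} (hx : x ∈ low K p l (i + 1)) (hy : y ∈ low K p l (i + 1)) {a b c : B}
    (hxa : hits p l i x = {a}) (hya : hits p l i y = {a}) (hb : hits p l i (T x) = {b})
    (hc : hits p l i (T y) = {c}) : b = c := by
  by_contra hbc
  have hsum : ∀ d, d = b ∨ d = c → d ∈ hits p l i (T (x + y)) := by
    have hb' : b ∈ hits p l i (T x) := hb ▸ rfl
    have hc' : c ∈ hits p l i (T y) := hc ▸ rfl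
    rintro d (rfl | rfl)
    · obtain ⟨hd, v, hv, hne⟩ := hb'
      refine ⟨hd, v, hv, ?_⟩
      have : T y v = 0 := by
        by_contra h
        have : d ∈ hits p l i (T y) := ⟨hd, v, hv, h⟩
        rw [hc] at this
        exact hbc this
      simpa [this] using hne
    · obtain ⟨hd, v, hv, hne⟩ := hc'
      refine ⟨hd, v, hv, ?_⟩
      have : T x v = 0 := by
        by_contra h
        have : d ∈ hits p l i (T x) := ⟨hd, v, hv, h⟩
        rw [hb] at this
        exact hbc this.symm
      simpa [this] using hne
  have hxy := Submodule.add_mem _ hx hy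
  have hsub : hits p l i (x + y) ⊆ {a} := by
    simpa [hxa, hya] using hits_add_subset (p := p) (l := l) i x y
  rcases Set.subset_singleton_iff_eq.1 hsub with h | h
  · rw [hits_eq_empty_iff hxy, ← mem_low_iff_of_blockWt_eq (hT _), ← hits_eq_empty_iff
      ((mem_low_iff_of_blockWt_eq (hT _) _).2 hxy)] at h
    exact (h ▸ hsum b (Or.inl rfl) : b ∈ (∅ : Set B))
  · obtain ⟨d, hd⟩ := exists_hits_eq_singleton hT hxy h
    rw [hd] at hsum
    exact hbc ((hsum b (Or.inl rfl)).trans (hsum c (Or.inr rfl)).symm)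

variable (p l) in
/-- An isometry relates the blocks `a` and `b` of level `i` if it maps some word with top block `a`
to a word with top block `b`. -/
def BlockRel (T : (V → K) ≃ₗ[K] (V → K)) (i : ℕ) (a b : B) : Prop :=
  ∃ x ∈ low K p l (i + 1), hits p l i x = {a} ∧ hits p l i (T x) = {b}

theorem blockRel_symm_iff (hT : ∀ x, blockWt p l (T x) = blockWt p l x) {i : ℕ} {a b : B} :
    BlockRel p l T.symm i b a ↔ BlockRel p l T i a b := by
  constructor
  · rintro ⟨x, hx, hb, ha⟩
    exact ⟨T.symm x, (mem_low_iff_of_blockWt_eq (blockWt_symm hT x) _).2 hx, ha, by simpa using hb⟩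
  · rintro ⟨x, hx, ha, hb⟩
    exact ⟨T x, (mem_low_iff_of_blockWt_eq (hT x) _).2 hx, hb, by simpa using ha⟩

theorem BlockRel.right_unique (hT : ∀ x, blockWt p l (T x) = blockWt p l x) {i : ℕ} {a b c : B}
    (hb : BlockRel p l T i a b) (hc : BlockRel p l T i a c) : b = c := by
  obtain ⟨x, hx, hxa, hxb⟩ := hb
  obtain ⟨y, hy, hya, hyc⟩ := hc
  exact hits_map_eq_of_hits_eq_singleton hT hx hy hxa hya hxb hyc

theorem BlockRel.left_unique (hT : ∀ x, blockWt p l (T x) = blockWt p l x) {i : ℕ} {a b c : B}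
    (ha : BlockRel p l T i a c) (hb : BlockRel p l T i b c) : a = b :=
  BlockRel.right_unique (blockWt_symm hT) ((blockRel_symm_iff hT).2 ha)
    ((blockRel_symm_iff hT).2 hb)

theorem BlockRel.ncard_eq (hT : ∀ x, blockWt p l (T x) = blockWt p l x) {i : ℕ} {a b : B}
    (h : BlockRel p l T i a b) : (p ⁻¹' {a}).ncard = (p ⁻¹' {b}).ncard := by
  obtain ⟨x, hx, ha, hb⟩ := h
  have := levelWt_eq_of_blockWt_eq (hT x).symm hx
  rwa [levelWt, levelWt, ha, hb] at this

/-- Expand `x` in the standard basis: some basis vector in its support has an image that is nonzero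
at a vertex of `b`. It must sit on level `i`, because `T` preserves the filtration, and its single
top block is the required `a`. -/
theorem exists_blockRel_left (hT : ∀ x, blockWt p l (T x) = blockWt p l x) {i : ℕ} {x : V → K}
    (hx : x ∈ low K p l (i + 1)) {b : B} (hb : b ∈ hits p l i (T x)) :
    ∃ a ∈ hits p l i x, BlockRel p l T i a b := by
  classical
  have := Fintype.ofFinite V
  obtain ⟨hb, w, rfl, hw⟩ := hb
  have hsum : T x w = ∑ v, x v * T (Pi.single v 1) w := by
    conv_lhs => rw [pi_eq_sum_univ' x]
    simp [map_sum, Finset.sum_apply]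
  rw [hsum] at hw
  obtain ⟨v, -, hv⟩ := Finset.exists_ne_zero_of_sum_ne_zero hw
  have hxv := left_ne_zero_of_mul hv
  have hTv := right_ne_zero_of_mul hv
  have hlow : ∀ j, l (p v) < j → Pi.single v (1 : K) ∈ low K p l j := fun j hj u hu => by
    have huv : u ≠ v := fun h => by subst h; omega
    simp [huv]
  have hlv : l (p v) < i + 1 := not_le.1 fun h => hxv (hx v h)
  have hlv' : l (p v) = i := by
    refine (Nat.lt_succ_iff.1 hlv).antisymm (not_lt.1 fun h => hTv ?_)
    exact (mem_low_iff_of_blockWt_eq (hT _) i).2 (hlow i h) w hb.ge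
  have hsingle : hits p l i (Pi.single v (1 : K)) = {p v} := by
    ext c
    constructor
    · rintro ⟨-, u, rfl, hu⟩
      have huv : u = v := by
        by_contra h
        simp [h] at hu
      rw [huv]
      rfl
    · rintro rfl
      exact ⟨hlv', v, rfl, by simp⟩
  obtain ⟨c, hc⟩ := exists_hits_eq_singleton hT (hlow _ hlv) hsingle
  have hwc : p w = c := by
    have : p w ∈ hits p l i (T (Pi.single v 1)) := ⟨hb, w, rfl, hTv⟩
    rwa [hc] at this
  exact ⟨p v, ⟨hlv', v, rfl, hxv⟩, _, hlow _ hlv, hsingle, hwc ▸ hc⟩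

theorem exists_blockRel_right (hT : ∀ x, blockWt p l (T x) = blockWt p l x) {i : ℕ} {x : V → K}
    (hx : x ∈ low K p l (i + 1)) {a : B} (ha : a ∈ hits p l i x) :
    ∃ b ∈ hits p l i (T x), BlockRel p l T i a b := by
  have ha' : a ∈ hits p l i (T.symm (T x)) := by simpa using ha
  obtain ⟨b, hb, h⟩ := exists_blockRel_left (blockWt_symm hT)
    ((mem_low_iff_of_blockWt_eq (hT x) _).2 hx) ha'
  exact ⟨b, hb, (blockRel_symm_iff hT).1 h⟩

theorem hits_map_subset (hT : ∀ x, blockWt p l (T x) = blockWt p l x) {i : ℕ} {x y : V → K}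
    (hx : x ∈ low K p l (i + 1)) (hy : y ∈ low K p l (i + 1))
    (h : hits p l i x ⊆ hits p l i y) : hits p l i (T x) ⊆ hits p l i (T y) := by
  intro b hb
  obtain ⟨a, ha, hab⟩ := exists_blockRel_left hT hx hb
  obtain ⟨c, hc, hac⟩ := exists_blockRel_right hT hy (h ha)
  rwa [BlockRel.right_unique hT hab hac]

theorem exists_equiv_hits (hT : ∀ x, blockWt p l (T x) = blockWt p l x) {i : ℕ} {x : V → K}
    (hx : x ∈ low K p l (i + 1)) :
    ∃ g : hits p l i x ≃ hits p l i (T x),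
      ∀ a : hits p l i x, (p ⁻¹' {(a : B)}).ncard = (p ⁻¹' {(g a : B)}).ncard := by
  choose f hf hrel using fun a : hits p l i x => exists_blockRel_right hT hx a.2
  refine ⟨Equiv.ofBijective (fun a => ⟨f a, hf a⟩) ⟨fun a b hab => ?_, fun b => ?_⟩,
    fun a => (hrel a).ncard_eq hT⟩
  · have hab : f a = f b := congrArg Subtype.val hab
    exact Subtype.ext ((hrel a).left_unique hT (hab ▸ hrel b))
  · obtain ⟨a, ha, h⟩ := exists_blockRel_left hT hx b.2
    exact ⟨⟨a, ha⟩, Subtype.ext ((hrel ⟨a, ha⟩).right_unique hT h)⟩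

end Rigidity

end LeveledBlocks

/-! ### Matching families of subspaces -/

theorem exists_perm_of_card_fiber_eq {I Y : Type*} [Finite I] {f g : I → Y}
    (h : ∀ y, Nat.card {a // f a = y} = Nat.card {a // g a = y}) :
    ∃ σ : Equiv.Perm I, ∀ a, g (σ a) = f a := by
  have e : ∀ y, Nonempty ({a // f a = y} ≃ {a // g a = y}) := fun y =>
    Finite.card_eq.1 (h y)
  refine ⟨(Equiv.sigmaFiberEquiv f).symm.trans
    ((Equiv.sigmaCongrRight fun y => (e y).some).trans (Equiv.sigmaFiberEquiv g)), fun a => ?_⟩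
  exact ((e (f a)).some ⟨a, rfl⟩).2

/-- The sign character of a linear functional over the field with two elements. -/
noncomputable def signChar {K D : Type*} [Field K] (hK : ∀ r : K, r = 0 ∨ r = 1) [AddCommGroup D]
    [Module K D] (f : D →ₗ[K] K) : Multiplicative D →* ℚ := by
  classical
  exact
  { toFun := fun d => if f d.toAdd = 0 then 1 else -1
    map_one' := by simp
    map_mul' := fun a b => by
      have h2 : (1 + 1 : K) = 0 := (hK (1 + 1)).resolve_right (by simp)
      rcases hK (f a.toAdd) with ha | ha <;> rcases hK (f b.toAdd) with hb | hb <;>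
        simp [ha, hb, h2] }

theorem signChar_apply {K D : Type*} [Field K] [DecidableEq K] (hK : ∀ r : K, r = 0 ∨ r = 1)
    [AddCommGroup D] [Module K D] (f : D →ₗ[K] K) (d : Multiplicative D) :
    signChar hK f d = if f d.toAdd = 0 then 1 else -1 := by
  simp only [signChar, MonoidHom.coe_mk, OneHom.coe_mk]
  congr

theorem signChar_injective {K D : Type*} [Field K] (hK : ∀ r : K, r = 0 ∨ r = 1) [AddCommGroup D]
    [Module K D] : Function.Injective (signChar (D := D) hK) := by
  classical
  intro f g h
  ext d
  have hd := DFunLike.congr_fun h (Multiplicative.ofAdd d)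
  rw [signChar_apply, signChar_apply, toAdd_ofAdd] at hd
  rcases hK (f d) with hf | hf <;> rcases hK (g d) with hg | hg <;>
    simp only [hf, hg] at hd ⊢ <;> norm_num at hd

/-- Two families of functionals over the field with two elements agree up to a permutation if at
every point the same number of functionals of either family vanish. -/
theorem exists_perm_of_ncard_ne_zero_eq {K I D : Type*} [Field K]
    (hK : ∀ r : K, r = 0 ∨ r = 1) [Finite I] [AddCommGroup D] [Module K D] (f g : I → D →ₗ[K] K)
    (h : ∀ d, {a | f a d ≠ 0}.ncard = {a | g a d ≠ 0}.ncard) :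
    ∃ σ : Equiv.Perm I, ∀ a, g (σ a) = f a := by
  classical
  have := Fintype.ofFinite I
  -- Each functional contributes `1` where it vanishes and `-1` elsewhere, so the counts determine
  -- the sum of the characters.
  have hsum : ∀ (f : I → D →ₗ[K] K) (d : D),
      ∑ a, signChar hK (f a) (Multiplicative.ofAdd d) =
        (Fintype.card I : ℚ) - 2 * ({a | f a d ≠ 0}.ncard : ℚ) := by
    intro f d
    have h1 : ∀ a, signChar hK (f a) (Multiplicative.ofAdd d) =
        1 - 2 * (if f a d ≠ 0 then (1 : ℚ) else 0) := by
      intro a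
      rw [signChar_apply, toAdd_ofAdd]
      split_ifs <;> norm_num
      contradiction
    rw [Finset.sum_congr rfl fun a _ => h1 a, Finset.sum_sub_distrib, ← Finset.mul_sum,
      Finset.sum_boole, Set.ncard_eq_toFinset_card']
    simp
  have hcomb : Finsupp.linearCombination ℚ (fun χ : Multiplicative D →* ℚ => (χ : _ → ℚ))
        (∑ a, Finsupp.single (signChar hK (f a)) 1) =
      Finsupp.linearCombination ℚ (fun χ : Multiplicative D →* ℚ => (χ : _ → ℚ))
        (∑ a, Finsupp.single (signChar hK (g a)) 1) := by
    ext d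
    have h1 := hsum f d.toAdd
    have h2 := hsum g d.toAdd
    rw [h] at h1
    simpa [map_sum, Finset.sum_apply] using h1.trans h2.symm
  -- Distinct characters are linearly independent, so each one occurs equally often in both
  -- families.
  have hfin := linearIndependent_monoidHom (Multiplicative D) ℚ hcomb
  refine exists_perm_of_card_fiber_eq fun φ => ?_
  have hφ := DFunLike.congr_fun hfin (signChar hK φ)
  simp only [Finsupp.finsetSum_apply, Finsupp.single_apply, Finset.sum_boole,
    (signChar_injective hK).eq_iff] at hφ
  rw [Nat.card_eq_fintype_card, Nat.card_eq_fintype_card, Fintype.card_subtype,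
    Fintype.card_subtype]
  exact_mod_cast hφ

/-- Two pairs of subspaces agree up to order if every vector lies in the same number of subspaces
of either pair. -/
theorem Submodule.pair_eq_or_eq_swap {R D : Type*} [Ring R] [AddCommGroup D] [Module R D]
    {K₁ K₂ L₁ L₂ : Submodule R D} (hinf : ∀ d, d ∈ K₁ ∧ d ∈ K₂ ↔ d ∈ L₁ ∧ d ∈ L₂)
    (hsup : ∀ d, d ∈ K₁ ∨ d ∈ K₂ ↔ d ∈ L₁ ∨ d ∈ L₂) :
    (L₁ = K₁ ∧ L₂ = K₂) ∨ (L₁ = K₂ ∧ L₂ = K₁) := by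
  -- A subgroup inside a union of two subgroups lies in one of them. Equal unions thus match the
  -- larger members; when one member contains the other, equal intersections match the smaller ones.
  have hcov : ∀ {H M N : Submodule R D}, (∀ d ∈ H, d ∈ M ∨ d ∈ N) → H ≤ M ∨ H ≤ N :=
    fun h => AddSubgroupClass.subset_union.1 h
  have h1 : K₁ ≤ L₁ ∨ K₁ ≤ L₂ := hcov fun d hd => (hsup d).1 (Or.inl hd)
  have h2 : K₂ ≤ L₁ ∨ K₂ ≤ L₂ := hcov fun d hd => (hsup d).1 (Or.inr hd)
  have h3 : L₁ ≤ K₁ ∨ L₁ ≤ K₂ := hcov fun d hd => (hsup d).2 (Or.inl hd)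
  have h4 : L₂ ≤ K₁ ∨ L₂ ≤ K₂ := hcov fun d hd => (hsup d).2 (Or.inr hd)
  simp only [le_antisymm_iff, SetLike.le_def] at *
  grind

/-- For two indices the count tells membership in the intersection (count zero) and in the union
(count at most one). Three indices would be too many: in the plane over the field with two elements,
the family `0, 0, ⊤` has the same counts as the three lines. -/
theorem Submodule.exists_perm_of_ncard_notMem_eq {R I D : Type*} [Finite I] [Ring R]
    [AddCommGroup D] [Module R D] (hI : Nat.card I ≤ 2) (K L : I → Submodule R D)
    (h : ∀ d, {a | d ∉ K a}.ncard = {a | d ∉ L a}.ncard) :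
    ∃ σ : Equiv.Perm I, ∀ a, L (σ a) = K a := by
  classical
  have := Fintype.ofFinite I
  obtain ⟨n, ⟨e⟩⟩ := Finite.exists_equiv_fin I
  have hn : n ≤ 2 := by rwa [Nat.card_congr e, Nat.card_fin] at hI
  have hsum : ∀ d, ∑ j, (if d ∉ K (e.symm j) then 1 else 0) =
      ∑ j, (if d ∉ L (e.symm j) then 1 else 0) := fun d => by
    have h1 : ∀ K : I → Submodule R D, {a | d ∉ K a}.ncard =
        ∑ j, (if d ∉ K (e.symm j) then 1 else 0) := fun K => by
      rw [Equiv.sum_comp e.symm fun a => if d ∉ K a then 1 else 0, Finset.sum_boole,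
        Set.ncard_eq_toFinset_card']
      simp
    rw [← h1, ← h1, h]
  suffices ∃ σ : Equiv.Perm (Fin n), ∀ j, L (e.symm (σ j)) = K (e.symm j) by
    obtain ⟨σ, hσ⟩ := this
    refine ⟨(e.trans σ).trans e.symm, fun a => ?_⟩
    simpa using hσ (e a)
  interval_cases n
  · exact ⟨Equiv.refl _, fun j => j.elim0⟩
  · refine ⟨Equiv.refl _, fun j => ?_⟩
    ext d
    have := hsum d
    rw [Fin.sum_univ_one, Fin.sum_univ_one] at this
    rw [Subsingleton.elim j 0, Equiv.refl_apply]
    split_ifs at this <;> simp_all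
  · simp only [Fin.sum_univ_two] at hsum
    have hpair := Submodule.pair_eq_or_eq_swap (K₁ := K (e.symm 0)) (K₂ := K (e.symm 1))
      (L₁ := L (e.symm 0)) (L₂ := L (e.symm 1))
      (fun d => by have := hsum d; grind) (fun d => by have := hsum d; grind)
    rcases hpair with ⟨h0, h1⟩ | ⟨h0, h1⟩
    · refine ⟨Equiv.refl _, fun j => ?_⟩
      fin_cases j
      · exact h0
      · exact h1
    · refine ⟨Equiv.swap 0 1, fun j => ?_⟩
      fin_cases j
      · simpa using h1
      · simpa using h0

/-! ### Extending linear maps -/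

/-- A linear isomorphism between subspaces of spaces of the same finite dimension extends. -/
theorem LinearEquiv.exists_extend_of_finrank_eq {K U U' : Type*} [Field K] [AddCommGroup U]
    [Module K U] [AddCommGroup U'] [Module K U'] [FiniteDimensional K U] [FiniteDimensional K U']
    (hU : Module.finrank K U = Module.finrank K U') {M : Submodule K U} {M' : Submodule K U'}
    (e : M ≃ₗ[K] M') : ∃ E : U ≃ₗ[K] U', ∀ x : M, E x = e x := by
  obtain ⟨N, hN⟩ := M.exists_isCompl
  obtain ⟨N', hN'⟩ := M'.exists_isCompl
  have h1 := Submodule.finrank_add_eq_of_isCompl hN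
  have h2 := Submodule.finrank_add_eq_of_isCompl hN'
  have h3 := e.finrank_eq
  have e' : N ≃ₗ[K] N' := LinearEquiv.ofFinrankEq _ _ (by omega)
  refine ⟨(Submodule.prodEquivOfIsCompl M N hN).symm ≪≫ₗ (e.prodCongr e') ≪≫ₗ
    Submodule.prodEquivOfIsCompl M' N' hN', fun x => ?_⟩
  simp

/-- Both ranges are the quotient of `D` by the common kernel; the resulting isomorphism of ranges
extends by equality of dimensions. -/
theorem LinearMap.exists_linearEquiv_of_ker_eq {K D U U' : Type*} [Field K] [AddCommGroup D]
    [Module K D] [AddCommGroup U] [Module K U] [AddCommGroup U'] [Module K U']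
    [FiniteDimensional K U] [FiniteDimensional K U']
    (hU : Module.finrank K U = Module.finrank K U') {f : D →ₗ[K] U} {g : D →ₗ[K] U'}
    (h : LinearMap.ker f = LinearMap.ker g) : ∃ E : U ≃ₗ[K] U', ∀ d, E (f d) = g d := by
  obtain ⟨E, hE⟩ := LinearEquiv.exists_extend_of_finrank_eq hU
    (f.quotKerEquivRange.symm ≪≫ₗ Submodule.quotEquivOfEq _ _ h ≪≫ₗ g.quotKerEquivRange)
  refine ⟨E, fun d => ?_⟩
  have hd : f.quotKerEquivRange.symm ⟨f d, LinearMap.mem_range_self f d⟩ =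
      Submodule.Quotient.mk d := by
    rw [LinearEquiv.symm_apply_eq]
    exact Subtype.ext (f.quotKerEquivRange_apply_mk d).symm
  have := hE ⟨f d, LinearMap.mem_range_self f d⟩
  rw [LinearEquiv.trans_apply, LinearEquiv.trans_apply, hd, Submodule.quotEquivOfEq_mk,
    LinearMap.quotKerEquivRange_apply_mk] at this
  exact this

/-- Every subspace is the image of a projection that respects a given finite filtration. -/
theorem Submodule.exists_projection_respecting {K E : Type*} [Field K] [AddCommGroup E]
    [Module K E] (C : Submodule K E) {W : ℕ → Submodule K E} (hW : Monotone W) {n : ℕ}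
    (hn : W n = ⊤) (h0 : W 0 = ⊥) :
    ∃ P : E →ₗ[K] C, (∀ c : C, P c = c) ∧ ∀ i, ∀ x ∈ W i, (P x : E) ∈ W i := by
  -- Induction on `m`: the projection need only respect the filtration on `C ⊔ W m`, but there it
  -- must do so for every step `W j`.
  have key : ∀ m, ∃ P : E →ₗ[K] C, (∀ c : C, P c = c) ∧
      ∀ j, ∀ x ∈ C ⊔ W m, x ∈ W j → (P x : E) ∈ W j := by
    intro m
    induction m with
    | zero =>
      obtain ⟨P, hP⟩ := C.subtype.exists_leftInverse_of_injective C.ker_subtype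
      have hP' : ∀ c : C, P c = c := fun c => LinearMap.congr_fun hP c
      refine ⟨P, hP', fun j x hx hxj => ?_⟩
      rw [h0, sup_bot_eq] at hx
      rwa [hP' ⟨x, hx⟩]
    | succ m ih =>
      obtain ⟨P, hP, hPW⟩ := ih
      -- The new directions of `W (m + 1)`, those complementary to its intersection with `C ⊔ W m`,
      -- are sent to zero before the old projection is applied.
      obtain ⟨N, hN⟩ := ((C ⊔ W m).submoduleOf (W (m + 1))).exists_isCompl
      set N' := N.map (W (m + 1)).subtype with hN'
      have hdisj : Disjoint N' (C ⊔ W m) := by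
        rw [Submodule.disjoint_def]
        rintro - ⟨y, hy, rfl⟩ hyC
        have := Submodule.disjoint_def.1 hN.disjoint y hyC hy
        simp [this]
      obtain ⟨Q, hNQ, hQ⟩ := hdisj.exists_isCompl
      set π := (C ⊔ W m).projection Q hQ.symm with hπ
      have hπ1 : ∀ x ∈ C ⊔ W m, π x = x := fun x hx =>
        Submodule.projection_apply_left hQ.symm ⟨x, hx⟩
      have hπ2 : ∀ x ∈ N', π x = 0 := fun x hx =>
        Submodule.projection_apply_right hQ.symm ⟨x, hNQ hx⟩
      refine ⟨P ∘ₗ π, fun c => ?_, fun j x hx hxj => ?_⟩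
      · rw [LinearMap.comp_apply, hπ1 c (Submodule.mem_sup_left c.2), hP]
      · obtain ⟨c, hc, w, hw, rfl⟩ := Submodule.mem_sup.1 hx
        have hw' : (⟨w, hw⟩ : W (m + 1)) ∈ (C ⊔ W m).submoduleOf (W (m + 1)) ⊔ N :=
          hN.codisjoint.eq_top ▸ Submodule.mem_top
        obtain ⟨y, hy, z, hz, hyz⟩ := Submodule.mem_sup.1 hw'
        have hwyz : w = y + z := (congrArg Subtype.val hyz).symm
        have hy : (y : E) ∈ C ⊔ W m := hy
        have hcy : c + y ∈ C ⊔ W m := Submodule.add_mem _ (Submodule.mem_sup_left hc) hy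
        have hzN : (z : E) ∈ N' := ⟨z, hz, rfl⟩
        have hx' : c + w = (c + y) + z := by rw [hwyz, add_assoc]
        have hπx : π (c + w) = c + y := by
          rw [hx', map_add, hπ1 _ hcy, hπ2 _ hzN, add_zero]
        rw [LinearMap.comp_apply, hπx]
        refine hPW j _ hcy ?_
        by_cases hj : m + 1 ≤ j
        -- The discarded part `z` lies in `W (m + 1)`, hence in `W j`.
        · have : c + (y : E) = (c + w) - z := by rw [hx']; abel
          rw [this]
          exact Submodule.sub_mem _ hxj (hW hj z.2)
        -- Here `j ≤ m`, so the word already lies in `W m` and nothing is discarded: `z = 0`.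
        · have hzC : (z : E) ∈ C ⊔ W m := by
            have : (z : E) = (c + w) - (c + y) := by rw [hx']; abel
            rw [this]
            exact Submodule.sub_mem _ (Submodule.mem_sup_right (hW (by omega) hxj)) hcy
          have hz0 := Submodule.disjoint_def.1 hdisj z hzN hzC
          rwa [hx', hz0, add_zero] at hxj
  obtain ⟨P, hP, hPW⟩ := key n
  exact ⟨P, hP, fun i x hx => hPW i x (by rw [hn, sup_top_eq]; exact Submodule.mem_top) hx⟩

/-! ### Extending isometries between codes -/

namespace LeveledBlocks

variable {V B K : Type*} [Field K] {p : V → B} {l : B → ℕ}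

section Restriction

variable (p) in
/-- The restriction of words to a block. -/
def resBlock (a : B) : (V → K) →ₗ[K] ({v // p v = a} → K) := LinearMap.funLeft K K Subtype.val

theorem resBlock_eq_zero_iff {a : B} {x : V → K} :
    resBlock p a x = 0 ↔ ∀ v, p v = a → x v = 0 :=
  ⟨fun h v hv => congrFun h ⟨v, hv⟩, fun h => funext fun v => h v v.2⟩

theorem mem_hits_iff {i : ℕ} {a : B} {x : V → K} :
    a ∈ hits p l i x ↔ l a = i ∧ resBlock p a x ≠ 0 := by
  rw [Ne, resBlock_eq_zero_iff, hits]
  simp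

theorem mem_low_iff_resBlock {i : ℕ} {x : V → K} :
    x ∈ low K p l i ↔ ∀ a, i ≤ l a → resBlock p a x = 0 := by
  simp only [resBlock_eq_zero_iff]
  exact ⟨fun h a ha v hv => h v (hv ▸ ha), fun h v hv => h _ hv v rfl⟩

/-- The linear map that moves every block `a` to the block `σ a` by a prescribed isomorphism. -/
def blockMap (σ : Equiv.Perm B) (E : ∀ a, ({v // p v = a} → K) ≃ₗ[K] ({v // p v = σ a} → K)) :
    (V → K) →ₗ[K] (V → K) :=
  LinearMap.pi fun v => LinearMap.proj (⟨v, by simp⟩ : {u // p u = σ (σ.symm (p v))}) ∘ₗ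
    (E (σ.symm (p v))).toLinearMap ∘ₗ resBlock p (σ.symm (p v))

theorem resBlock_blockMap (σ : Equiv.Perm B)
    (E : ∀ a, ({v // p v = a} → K) ≃ₗ[K] ({v // p v = σ a} → K)) (x : V → K) (a : B) :
    resBlock p (σ a) (blockMap σ E x) = E a (resBlock p a x) := by
  ext ⟨v, hv⟩
  obtain rfl : a = σ.symm (p v) := by simp [hv]
  rfl

end Restriction

theorem exists_perm_of_fiberwise {I Y : Type*} (f : I → Y) {P : I → I → Prop}
    (h : ∀ y, ∃ σ : Equiv.Perm {a // f a = y}, ∀ a : {a // f a = y}, P a (σ a)) :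
    ∃ σ : Equiv.Perm I, ∀ a, f (σ a) = f a ∧ P a (σ a) := by
  choose σ hσ using h
  refine ⟨(Equiv.sigmaFiberEquiv f).symm.trans
    ((Equiv.sigmaCongrRight σ).trans (Equiv.sigmaFiberEquiv f)), fun a => ⟨?_, ?_⟩⟩
  · exact (σ (f a) ⟨a, rfl⟩).2
  · exact hσ (f a) ⟨a, rfl⟩

variable [Finite V]

theorem sum_ncard_fiber (p : V → B) (S : Finset B) :
    ∑ a ∈ S, (p ⁻¹' {a}).ncard = (p ⁻¹' (S : Set B)).ncard := by
  classical
  induction S using Finset.induction_on with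
  | empty => simp
  | insert a S ha ih =>
    rw [Finset.sum_insert ha, ih, Finset.coe_insert, Set.insert_eq, Set.preimage_union,
      Set.ncard_union_eq]
    exact Disjoint.preimage _ (by simpa using ha)

/-- Among blocks of one level and size, the restrictions of `c` and of `t c` are nonzero equally
often. The kernels of these restrictions, on the codewords below level `i + 1`, therefore agree up
to a permutation of the blocks. -/
theorem exists_perm_hits {C : Submodule K (V → K)}
    (t : C →ₗ[K] (V → K)) (hK : ∀ r : K, r = 0 ∨ r = 1)
    (hp : Function.Surjective p) {i k : ℕ}
    (hΩ : 1 < k → {a | l a = i ∧ (p ⁻¹' {a}).ncard = k}.encard ≤ 2)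
    (ht : ∀ c : C, (c : V → K) ∈ low K p l (i + 1) →
      (hits p l i (c : V → K) ∩ {a | (p ⁻¹' {a}).ncard = k}).ncard =
        (hits p l i (t c) ∩ {a | (p ⁻¹' {a}).ncard = k}).ncard) :
    ∃ σ : Equiv.Perm {a : B // (l a, (p ⁻¹' {a}).ncard) = (i, k)},
      ∀ a : {a : B // (l a, (p ⁻¹' {a}).ncard) = (i, k)}, ∀ c : C,
        (c : V → K) ∈ low K p l (i + 1) →
        (resBlock p (a : B) (c : V → K) = 0 ↔ resBlock p (σ a : B) (t c) = 0) := by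
  classical
  have hB : Finite B := Finite.of_surjective p hp
  set I := {a : B // (l a, (p ⁻¹' {a}).ncard) = (i, k)} with hI
  have hIl : ∀ a : I, l a = i := fun a => (Prod.ext_iff.1 a.2).1
  have hIk : ∀ a : I, (p ⁻¹' {(a : B)}).ncard = k := fun a => (Prod.ext_iff.1 a.2).2
  set D := (low K p l (i + 1)).comap C.subtype with hD
  set f : ∀ a : I, D →ₗ[K] ({v // p v = a} → K) :=
    fun a => resBlock p a ∘ₗ C.subtype ∘ₗ D.subtype with hf
  set g : ∀ a : I, D →ₗ[K] ({v // p v = a} → K) :=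
    fun a => resBlock p a ∘ₗ t ∘ₗ D.subtype with hg
  have himage : ∀ x : V → K, hits p l i x ∩ {a | (p ⁻¹' {a}).ncard = k} =
      Subtype.val '' {a : I | resBlock p (a : B) x ≠ 0} := by
    intro x
    ext a
    constructor
    · rintro ⟨h1, h2⟩
      rw [mem_hits_iff] at h1
      exact ⟨⟨a, Prod.ext h1.1 h2⟩, h1.2, rfl⟩
    · rintro ⟨a, ha, rfl⟩
      exact ⟨mem_hits_iff.2 ⟨hIl a, ha⟩, hIk a⟩
  have hcount : ∀ d : D, {a | f a d ≠ 0}.ncard = {a | g a d ≠ 0}.ncard := by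
    intro d
    have := ht d.1 d.2
    rwa [himage, himage, Set.ncard_image_of_injective _ Subtype.val_injective,
      Set.ncard_image_of_injective _ Subtype.val_injective] at this
  suffices ∃ σ : Equiv.Perm I, ∀ a, LinearMap.ker (g (σ a)) = LinearMap.ker (f a) by
    obtain ⟨σ, hσ⟩ := this
    refine ⟨σ, fun a c hc => ?_⟩
    have := SetLike.ext_iff.1 (hσ a) ⟨c, hc⟩
    exact this.symm
  rcases lt_trichotomy k 1 with hk | hk | hk
  · have : IsEmpty I := ⟨fun a => by
      obtain ⟨v, hv⟩ := hp a
      have h0 := hIk a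
      have h0 := (Set.ncard_eq_zero (Set.toFinite _)).1 (h0.trans (Nat.lt_one_iff.1 hk))
      exact (h0 ▸ (hv : v ∈ p ⁻¹' {(a : B)}) : v ∈ (∅ : Set V))⟩
    exact ⟨Equiv.refl _, fun a => isEmptyElim a⟩
  -- A block of size one makes the restriction a single functional, so any number of blocks can be
  -- matched by characters.
  · subst hk
    have huniq : ∀ a : I, ∃ v : {v // p v = (a : B)}, ∀ w, w = v := by
      intro a
      obtain ⟨v, hv⟩ := Set.ncard_eq_one.1 (hIk a)
      have hv' : p v = a := (hv ▸ Set.mem_singleton v : v ∈ p ⁻¹' {(a : B)})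
      refine ⟨⟨v, hv'⟩, fun w => Subtype.ext ?_⟩
      have : (w : V) ∈ p ⁻¹' {(a : B)} := w.2
      rwa [hv] at this
    choose v hv using huniq
    have hzero : ∀ a : I, ∀ x : {v // p v = (a : B)} → K, x = 0 ↔ x (v a) = 0 :=
      fun a x => ⟨fun h => by rw [h]; rfl, fun h => funext fun w => by rw [hv a w, h]; rfl⟩
    obtain ⟨σ, hσ⟩ := exists_perm_of_ncard_ne_zero_eq (D := D) hK
      (fun a : I => LinearMap.proj (v a) ∘ₗ f a) (fun a : I => LinearMap.proj (v a) ∘ₗ g a)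
      (fun d => by
        have := hcount d
        simp only [Ne, hzero] at this
        exact this)
    refine ⟨σ, fun a => ?_⟩
    ext d
    rw [LinearMap.mem_ker, LinearMap.mem_ker, hzero, hzero]
    have := LinearMap.congr_fun (hσ a) d
    simp only [LinearMap.comp_apply, LinearMap.proj_apply] at this
    rw [this]
  -- For larger blocks only kernels can be compared, and Ω bounds their number by two.
  · have hker : ∀ d : D, {a : I | d ∉ LinearMap.ker (f a)}.ncard =
        {a : I | d ∉ LinearMap.ker (g a)}.ncard := hcount
    refine Submodule.exists_perm_of_ncard_notMem_eq (D := D) ?_ _ _ hker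
    have h2 := hΩ hk
    have : {a : B | (l a, (p ⁻¹' {a}).ncard) = (i, k)}.encard ≤ 2 := by
      simpa only [Prod.mk.injEq] using h2
    rw [← Set.Finite.cast_ncard_eq (Set.toFinite _)] at this
    exact_mod_cast this

/-- Isometries between binary codes extend, if on each level the sizes of the blocks are determined
by the weight and every size above one occurs at most twice. -/
theorem exists_extension {C : Submodule K (V → K)}
    (t : C →ₗ[K] (V → K)) (hK : ∀ r : K, r = 0 ∨ r = 1)
    (hp : Function.Surjective p)
    (hU : ∀ i (S S' : Set B), (∀ a ∈ S, l a = i) → (∀ a ∈ S', l a = i) →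
      (p ⁻¹' S).ncard = (p ⁻¹' S').ncard → ∀ k,
        (S ∩ {a | (p ⁻¹' {a}).ncard = k}).ncard = (S' ∩ {a | (p ⁻¹' {a}).ncard = k}).ncard)
    (hΩ : ∀ i k, 1 < k → {a | l a = i ∧ (p ⁻¹' {a}).ncard = k}.encard ≤ 2)
    (ht : ∀ c : C, blockWt p l (t c) = blockWt p l (c : V → K)) :
    ∃ T : (V → K) →ₗ[K] (V → K),
      (∀ x, blockWt p l (T x) = blockWt p l x) ∧ ∀ c : C, T c = t c := by
  classical
  have := Fintype.ofFinite V
  have hB : Finite B := Finite.of_surjective p hp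
  obtain ⟨σ, hσ⟩ := exists_perm_of_fiberwise (fun a : B => (l a, (p ⁻¹' {a}).ncard))
    (P := fun a b => ∀ c : C, (c : V → K) ∈ low K p l (l a + 1) →
        (resBlock p a (c : V → K) = 0 ↔ resBlock p b (t c) = 0)) (by
      rintro ⟨i, k⟩
      obtain ⟨σ, hσ⟩ := exists_perm_hits t hK hp (hΩ i k) fun c hc =>
        hU i _ _ (fun a ha => ha.1) (fun a ha => ha.1)
          (levelWt_eq_of_blockWt_eq (ht c).symm hc) k
      refine ⟨σ, fun a c hc => hσ a c ?_⟩
      have hl : l a = i := (Prod.ext_iff.1 a.2).1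
      rwa [hl] at hc)
  have hσl : ∀ a, l (σ a) = l a := fun a => (Prod.ext_iff.1 (hσ a).1).1
  have hσk : ∀ a, (p ⁻¹' {σ a}).ncard = (p ⁻¹' {a}).ncard := fun a =>
    (Prod.ext_iff.1 (hσ a).1).2
  -- Equal kernels and equal block sizes turn the matching of blocks into isomorphisms that carry
  -- `c` to `t c` on top blocks.
  have hE : ∀ a, ∃ E : ({v // p v = a} → K) ≃ₗ[K] ({v // p v = σ a} → K),
      ∀ c : C, (c : V → K) ∈ low K p l (l a + 1) →
        E (resBlock p a c) = resBlock p (σ a) (t c) := by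
    intro a
    set D := (low K p l (l a + 1)).comap C.subtype with hD
    obtain ⟨E, hE⟩ := LinearMap.exists_linearEquiv_of_ker_eq (D := D)
      (f := resBlock p a ∘ₗ C.subtype ∘ₗ D.subtype)
      (g := resBlock p (σ a) ∘ₗ t ∘ₗ D.subtype)
      (by
        rw [Module.finrank_fintype_fun_eq_card, Module.finrank_fintype_fun_eq_card,
          ← Nat.card_eq_fintype_card, ← Nat.card_eq_fintype_card]
        exact (hσk a).symm)
      (by
        ext d
        exact (hσ a).2 d.1 d.2)
    exact ⟨E, fun c hc => hE ⟨c, hc⟩⟩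
  choose E hE using hE
  set S := blockMap σ E with hS
  obtain ⟨n, hn⟩ := exists_low_eq_top (K := K) (p := p) (l := l)
  obtain ⟨P, hPC, hPlow⟩ := Submodule.exists_projection_respecting C
    (low_mono (K := K) (p := p) (l := l)) hn low_zero
  have hSlow : ∀ i x, x ∈ low K p l i → S x ∈ low K p l i := by
    intro i x hx
    rw [mem_low_iff_resBlock] at hx ⊢
    intro a ha
    obtain ⟨b, rfl⟩ := σ.surjective a
    rw [hS, resBlock_blockMap, hx b (hσl b ▸ ha), map_zero]
  -- `P` keeps `x` below level `i + 1`, and on such codewords `t` and `S` agree on level `i`; so the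
  -- correction drops a level.
  have hNlow : ∀ i x, x ∈ low K p l (i + 1) →
      t (P x) - S (P x) ∈ low K p l i := by
    intro i x hx
    have hPx := hPlow _ _ hx
    have htP := (mem_low_iff_of_blockWt_eq (ht (P x)) (i + 1)).2 hPx
    have hSP := hSlow _ _ hPx
    rw [mem_low_iff_resBlock]
    intro a ha
    rcases ha.lt_or_eq with ha | ha
    · exact mem_low_iff_resBlock.1 (Submodule.sub_mem _ htP hSP) a ha
    · obtain ⟨b, rfl⟩ := σ.surjective a
      rw [map_sub, hS, resBlock_blockMap, hE b (P x) (by rwa [← hσl b, ← ha]), sub_self]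
  -- The correction restores `t` on `C`, where `P` is the identity, and cannot change which top
  -- blocks are met.
  set T : (V → K) →ₗ[K] (V → K) :=
    S + (t ∘ₗ P - S ∘ₗ C.subtype ∘ₗ P) with hT
  have hTx : ∀ x, T x = S x + (t (P x) - S (P x)) := fun x => rfl
  refine ⟨T, fun x => ?_, fun c => ?_⟩
  · by_cases hx0 : x = 0
    · rw [hx0, map_zero]
    obtain ⟨i, hx, hx'⟩ := exists_mem_low_succ (p := p) (l := l) hx0
    have hTlow : T x ∈ low K p l (i + 1) := by
      rw [hTx]
      exact Submodule.add_mem _ (hSlow _ _ hx) (low_mono (Nat.le_succ i) (hNlow i x hx))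
    refine (blockWt_eq_of_levelWt_eq hx hx' hTlow ?_).symm
    have hhits : hits p l i (T x) = σ '' hits p l i x := by
      ext a
      obtain ⟨b, rfl⟩ := σ.surjective a
      rw [σ.injective.mem_set_image, mem_hits_iff, mem_hits_iff, hσl]
      refine and_congr_right fun hb => not_congr ?_
      rw [hTx, map_add, mem_low_iff_resBlock.1 (hNlow i x hx) (σ b) (by rw [hσl, hb]), add_zero,
        hS, resBlock_blockMap, LinearEquiv.map_eq_zero_iff]
    rw [levelWt, levelWt, hhits]
    have hfin := Set.toFinite (hits p l i x)
    have hmap : σ '' (hfin.toFinset : Set B) = hfin.toFinset.map σ.toEmbedding := by simp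
    rw [← hfin.coe_toFinset, hmap, ← sum_ncard_fiber, ← sum_ncard_fiber,
      Finset.sum_map]
    exact Finset.sum_congr rfl fun a _ => (hσk a).symm
  · rw [hTx, hPC]
    abel

end LeveledBlocks

/-! ### Consequences of the extension property -/

namespace LeveledBlocks

variable {V B K : Type*} [Field K] {p : V → B} {l : B → ℕ}

theorem indicator_mem_low {i : ℕ} {X : Set V} (hX : ∀ v ∈ X, l (p v) = i) :
    X.indicator (1 : V → K) ∈ low K p l (i + 1) := by
  intro v hv
  refine Set.indicator_of_notMem (fun h => ?_) _
  have := hX v h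
  omega

theorem hits_indicator {i : ℕ} {X : Set V} (hX : ∀ v ∈ X, l (p v) = i) :
    hits p l i (X.indicator (1 : V → K)) = p '' X := by
  ext a
  constructor
  · rintro ⟨-, v, rfl, hv⟩
    exact ⟨v, Set.mem_of_indicator_ne_zero hv, rfl⟩
  · rintro ⟨v, hv, rfl⟩
    exact ⟨hX v hv, v, rfl, by simp [hv]⟩

variable [Finite V]

theorem blockWt_indicator_eq {i : ℕ} {X Y : Set V} (hX : ∀ v ∈ X, l (p v) = i)
    (hY : ∀ v ∈ Y, l (p v) = i) (hne : X.Nonempty)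
    (h : (p ⁻¹' (p '' X)).ncard = (p ⁻¹' (p '' Y)).ncard) :
    blockWt p l (X.indicator (1 : V → K)) = blockWt p l (Y.indicator (1 : V → K)) := by
  refine blockWt_eq_of_levelWt_eq (indicator_mem_low hX) ?_ (indicator_mem_low hY) ?_
  · rw [← hits_eq_empty_iff (indicator_mem_low hX), hits_indicator hX]
    exact (hne.image p).ne_empty
  · rw [levelWt, levelWt, hits_indicator hX, hits_indicator hY, h]

/-- Isometries that are given by a linear map on a subspace extend to linear isometries. -/
def HasExtension (K : Type*) [Field K] (p : V → B) (l : B → ℕ) : Prop :=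
  ∀ (C : Submodule K (V → K)) (φ : (V → K) →ₗ[K] (V → K)),
    (∀ c ∈ C, blockWt p l (φ c) = blockWt p l c) →
      ∃ T : (V → K) ≃ₗ[K] (V → K), (∀ x, blockWt p l (T x) = blockWt p l x) ∧ ∀ c ∈ C, T c = φ c

/-- The indicators of the two unions of blocks have equal weight, so some isometry carries one to
the other; it permutes blocks and preserves their sizes. -/
theorem HasExtension.exists_equiv (hE : HasExtension K p l) (hK : ∀ r : K, r = 0 ∨ r = 1)
    (hp : Function.Surjective p) {i : ℕ} {S S' : Set B} (hS : ∀ a ∈ S, l a = i)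
    (hS' : ∀ a ∈ S', l a = i) (hne : S.Nonempty)
    (h : (p ⁻¹' S).ncard = (p ⁻¹' S').ncard) :
    ∃ g : S ≃ S', ∀ a : S, (p ⁻¹' {(a : B)}).ncard = (p ⁻¹' {(g a : B)}).ncard := by
  obtain ⟨a, ha⟩ := hne
  obtain ⟨w, rfl⟩ := hp a
  have hX : ∀ v ∈ p ⁻¹' S, l (p v) = i := fun v hv => hS _ hv
  have hX' : ∀ v ∈ p ⁻¹' S', l (p v) = i := fun v hv => hS' _ hv
  set x : V → K := (p ⁻¹' S).indicator 1 with hx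
  set x' : V → K := (p ⁻¹' S').indicator 1 with hx'
  have hw : x w = 1 := Set.indicator_of_mem ha 1
  -- Since `x w = 1`, this map sends `x` to `x'`.
  obtain ⟨T, hT, hTx⟩ := hE (Submodule.span K {x}) ((LinearMap.proj w).smulRight x') (by
    intro c hc
    obtain ⟨r, rfl⟩ := Submodule.mem_span_singleton.1 hc
    rcases hK r with rfl | rfl
    · simp
    · rw [one_smul, LinearMap.smulRight_apply, LinearMap.proj_apply, hw, one_smul]
      refine (blockWt_indicator_eq hX hX' ⟨w, ha⟩ ?_).symm
      rw [Set.image_preimage_eq _ hp, Set.image_preimage_eq _ hp, h])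
  have hTx : T x = x' := by
    rw [hTx x (Submodule.mem_span_singleton_self x), LinearMap.smulRight_apply,
      LinearMap.proj_apply, hw, one_smul]
  obtain ⟨g, hg⟩ := exists_equiv_hits hT (indicator_mem_low hX)
  have h1 : hits p l i x = S := by rw [hits_indicator hX, Set.image_preimage_eq _ hp]
  have h2 : hits p l i (T x) = S' := by rw [hTx, hits_indicator hX', Set.image_preimage_eq _ hp]
  exact ⟨((Equiv.setCongr h1).symm.trans g).trans (Equiv.setCongr h2),
    fun a => hg ((Equiv.setCongr h1).symm a)⟩

/-- Given three blocks of size `k`, the words `x`, `y`, `x + y` all meet exactly `a` and `b`, while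
`x`, `y'`, `x + y'` meet the three different pairs. All six have level weight `2k`, so `x ↦ x`, `y ↦
y'` is an isometry; no extension exists, because isometries respect equality of the sets of blocks
met. The second vertices `a₂`, `b₂` need `k > 1`. -/
theorem HasExtension.encard_le_two (hE : HasExtension K p l) (hK : ∀ r : K, r = 0 ∨ r = 1)
    (hp : Function.Surjective p) (i : ℕ) {k : ℕ} (hk : 1 < k) :
    {a | l a = i ∧ (p ⁻¹' {a}).ncard = k}.encard ≤ 2 := by
  have hB : Finite B := Finite.of_surjective p hp
  rw [← Set.Finite.cast_ncard_eq (Set.toFinite _)]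
  by_contra hlt
  have hlt : 2 < {a | l a = i ∧ (p ⁻¹' {a}).ncard = k}.ncard := by
    rw [not_le] at hlt
    exact_mod_cast hlt
  obtain ⟨a, b, c, ⟨hla, hka⟩, ⟨hlb, hkb⟩, ⟨hlc, hkc⟩, hab, hac, hbc⟩ :=
    (Set.two_lt_ncard_iff (Set.toFinite _)).1 hlt
  have htwo : ∀ d, (p ⁻¹' {d}).ncard = k → ∃ v w, p v = d ∧ p w = d ∧ v ≠ w := fun d hd =>
    (Set.one_lt_ncard_iff (Set.toFinite _)).1 (hd ▸ hk)
  obtain ⟨a₁, a₂, ha₁, ha₂, ha⟩ := htwo a hka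
  obtain ⟨b₁, b₂, hb₁, hb₂, hb⟩ := htwo b hkb
  obtain ⟨c₁, -, hc₁, -, -⟩ := htwo c hkc
  have hpair : ∀ d e, d ≠ e → (p ⁻¹' {d}).ncard = k → (p ⁻¹' {e}).ncard = k →
      (p ⁻¹' {d, e}).ncard = k + k := fun d e hde hd he => by
    rw [Set.insert_eq, Set.preimage_union, Set.ncard_union_eq, hd, he]
    exact Disjoint.preimage _ (by simpa using hde)
  have h2 : (1 + 1 : K) = 0 := (hK (1 + 1)).resolve_right (by simp)
  have hne : ∀ {v w : V}, p v ≠ p w → v ≠ w := fun h e => h (congrArg p e)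
  have hab₁₁ : a₁ ≠ b₁ := hne (by rwa [ha₁, hb₁])
  have hab₁₂ : a₁ ≠ b₂ := hne (by rwa [ha₁, hb₂])
  have hab₂₁ : a₂ ≠ b₁ := hne (by rwa [ha₂, hb₁])
  have hab₂₂ : a₂ ≠ b₂ := hne (by rwa [ha₂, hb₂])
  have hac₁ : a₁ ≠ c₁ := hne (by rwa [ha₁, hc₁])
  have hbc₁ : b₁ ≠ c₁ := hne (by rwa [hb₁, hc₁])
  set x : V → K := ({a₁, b₁} : Set V).indicator 1 with hx
  set y : V → K := ({a₂, b₂} : Set V).indicator 1 with hy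
  set y' : V → K := ({b₁, c₁} : Set V).indicator 1 with hy'
  have hxy : x + y = ({a₁, b₁, a₂, b₂} : Set V).indicator 1 := by
    classical
    ext v
    simp only [hx, hy, Pi.add_apply, Set.indicator_apply, Set.mem_insert_iff,
      Set.mem_singleton_iff, Pi.one_apply]
    grind
  have hxy' : x + y' = ({a₁, c₁} : Set V).indicator 1 := by
    classical
    ext v
    simp only [hx, hy', Pi.add_apply, Set.indicator_apply, Set.mem_insert_iff,
      Set.mem_singleton_iff, Pi.one_apply]
    grind
  have hlx : ∀ v ∈ ({a₁, b₁} : Set V), l (p v) = i := by rintro v (rfl | rfl) <;> simp [*]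
  have hly : ∀ v ∈ ({a₂, b₂} : Set V), l (p v) = i := by rintro v (rfl | rfl) <;> simp [*]
  have hly' : ∀ v ∈ ({b₁, c₁} : Set V), l (p v) = i := by rintro v (rfl | rfl) <;> simp [*]
  have hlxy : ∀ v ∈ ({a₁, b₁, a₂, b₂} : Set V), l (p v) = i := by
    rintro v (rfl | rfl | rfl | rfl) <;> simp [*]
  have hlxy' : ∀ v ∈ ({a₁, c₁} : Set V), l (p v) = i := by rintro v (rfl | rfl) <;> simp [*]
  have hix : p '' {a₁, b₁} = {a, b} := by rw [Set.image_pair, ha₁, hb₁]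
  have hiy : p '' {a₂, b₂} = {a, b} := by rw [Set.image_pair, ha₂, hb₂]
  have hiy' : p '' {b₁, c₁} = {b, c} := by rw [Set.image_pair, hb₁, hc₁]
  have hixy : p '' {a₁, b₁, a₂, b₂} = {a, b} := by
    rw [Set.image_insert_eq, Set.image_insert_eq, hiy, ha₁, hb₁]
    simp
  have hixy' : p '' {a₁, c₁} = {a, c} := by rw [Set.image_pair, ha₁, hc₁]
  have hwy : blockWt p l y' = blockWt p l y :=
    blockWt_indicator_eq hly' hly ⟨b₁, Or.inl rfl⟩
      (by rw [hiy', hiy, hpair b c hbc hkb hkc, hpair a b hab hka hkb])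
  have hwxy : blockWt p l (x + y') = blockWt p l (x + y) := by
    rw [hxy, hxy']
    exact blockWt_indicator_eq hlxy' hlxy ⟨a₁, Or.inl rfl⟩
      (by rw [hixy', hixy, hpair a c hac hka hkc, hpair a b hab hka hkb])
  -- The coordinates at `a₁` and `a₂` are dual to `x` and `y`.
  set φ : (V → K) →ₗ[K] (V → K) :=
    (LinearMap.proj a₁).smulRight x + (LinearMap.proj a₂).smulRight y' with hφ
  have hφx : φ x = x := by
    have h₁ : x a₁ = 1 := by simp [hx]
    have h₂ : x a₂ = 0 := by simp [hx, ha.symm, hab₂₁]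
    simp [hφ, h₁, h₂]
  have hφy : φ y = y' := by
    have h₁ : y a₁ = 0 := by simp [hy, ha, hab₁₂]
    have h₂ : y a₂ = 1 := by simp [hy]
    simp [hφ, h₁, h₂]
  obtain ⟨T, hT, hTφ⟩ := hE (Submodule.span K {x, y}) φ (by
    intro d hd
    obtain ⟨r, s, rfl⟩ := Submodule.mem_span_pair.1 hd
    rw [map_add, map_smul, map_smul, hφx, hφy]
    rcases hK r with rfl | rfl <;> rcases hK s with rfl | rfl <;> simp [hwy, hwxy])
  have hTx := hTφ x (Submodule.subset_span (Or.inl rfl))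
  have hTy := hTφ y (Submodule.subset_span (Or.inr rfl))
  have hsub := hits_map_subset hT (indicator_mem_low hly) (indicator_mem_low hlx)
    (by rw [hits_indicator hly, hits_indicator hlx, hix, hiy])
  rw [hTx, hTy, hφx, hφy, hits_indicator hlx, hits_indicator hly', hix, hiy'] at hsub
  rcases hsub (Or.inr rfl : c ∈ ({b, c} : Set B)) with h | h
  · exact hac h.symm
  · exact hbc h.symm

end LeveledBlocks

/-! ### The block structure of a directed graph with a hierarchical poset -/

theorem Order.height_lt_top_of_finite {α : Type*} [Preorder α] [Finite α] (a : α) :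
    Order.height a < ⊤ := by
  have := Fintype.ofFinite α
  rw [lt_top_iff_ne_top, Ne, Order.height_eq_top_iff]
  intro h
  obtain ⟨s, -, hs⟩ := h (Fintype.card α)
  have := Fintype.card_le_of_injective _ s.strictMono.injective
  rw [Fintype.card_fin, hs] at this
  omega

namespace Digraph

variable {V : Type*} (G : Digraph V)

theorem proj_surjective : Function.Surjective G.proj := Quotient.exists_rep

instance [Finite V] : Finite G.RedVert := Finite.of_surjective _ G.proj_surjective

theorem proj_le_proj_iff {u v : V} : G.proj v ≤ G.proj u ↔ G.Dominates u v := by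
  constructor
  · rintro ⟨v', u', hv, hu, h⟩
    exact ((G.proj_eq_iff.1 hu).2.trans (G.mem_clo_singleton.1 h)).trans (G.proj_eq_iff.1 hv).1
  · exact fun h => ⟨v, u, rfl, rfl, G.mem_clo_singleton.2 h⟩

/-- The number of steps of a longest chain below an element of `P_G`. -/
noncomputable def depth (a : G.RedVert) : ℕ := (Order.height a).toNat

section Finite

variable [Finite V]

theorem coe_depth (a : G.RedVert) : (G.depth a : ℕ∞) = Order.height a :=
  ENat.natCast_toNat (Order.height_lt_top_of_finite a).ne

theorem mem_redLevel_iff {i : ℕ} {a : G.RedVert} : a ∈ G.redLevel i ↔ G.depth a + 1 = i := by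
  change Order.height a + 1 = i ↔ _
  rw [← G.coe_depth a]
  exact_mod_cast Iff.rfl

theorem depth_lt_depth {a b : G.RedVert} (h : a < b) : G.depth a < G.depth b := by
  have := Order.height_strictMono h (Order.height_lt_top_of_finite a)
  rw [← G.coe_depth, ← G.coe_depth] at this
  exact_mod_cast this

variable {G}

/-- The hypothesis speaks of adjacent levels only. A longest chain below `a` passes through every
smaller depth, so it contains an element one level above `b`. -/
theorem IsHierarchical.le_of_depth_lt (hG : G.IsHierarchical) {a b : G.RedVert}
    (h : G.depth b < G.depth a) : b ≤ a := by
  have key : ∀ c : G.RedVert, G.depth c = G.depth b + 1 → b ≤ c := fun c hc =>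
    hG (G.depth b + 2) (by omega) c (G.mem_redLevel_iff.2 (by omega)) b
      (G.mem_redLevel_iff.2 (by omega))
  rcases (Nat.succ_le_of_lt h).lt_or_eq with h | h
  · rw [← ENat.natCast_lt_natCast, G.coe_depth a,
      Order.coe_lt_height_iff (Order.height_lt_top_of_finite a)] at h
    obtain ⟨c, hca, hc⟩ := h
    rw [← G.coe_depth] at hc
    exact (key c (by exact_mod_cast hc)).trans hca.le
  · exact key a h.symm

theorem IsHierarchical.dominates_iff (hG : G.IsHierarchical) {u v : V} :
    G.Dominates u v ↔ G.proj u = G.proj v ∨ G.depth (G.proj v) < G.depth (G.proj u) := by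
  rw [← G.proj_le_proj_iff]
  constructor
  · intro h
    rcases h.lt_or_eq with h | h
    · exact Or.inr (G.depth_lt_depth h)
    · exact Or.inl h.symm
  · rintro (h | h)
    · exact h.ge
    · exact hG.le_of_depth_lt h

theorem IsHierarchical.wt_eq (hG : G.IsHierarchical) {F : Type*} [Field F] (x : V → F) :
    G.wt x = LeveledBlocks.blockWt G.proj G.depth x := by
  rw [wt, LeveledBlocks.blockWt]
  congr 1
  ext v
  rw [G.mem_clo]
  simp only [hG.dominates_iff, Function.mem_support]
  rfl

theorem IsHierarchical.mem_linIsom_iff (hG : G.IsHierarchical) {F : Type*} [Field F]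
    {T : (V → F) ≃ₗ[F] (V → F)} : T ∈ G.linIsom F ↔
      ∀ x, LeveledBlocks.blockWt G.proj G.depth (T x) =
        LeveledBlocks.blockWt G.proj G.depth x := by
  change (∀ x y, G.wt (T y - T x) = G.wt (y - x)) ↔ _
  simp only [hG.wt_eq, ← map_sub]
  exact ⟨fun h x => by simpa using h 0 x, fun h x y => h _⟩

/-- Taking the whole space as target code removes the second code from the extension property. -/
theorem IsHierarchical.hasExtension (hG : G.IsHierarchical) {F : Type*} [Field F]
    (h : G.MacWilliamsExtension F) : LeveledBlocks.HasExtension F G.proj G.depth := by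
  intro C φ hφ
  obtain ⟨T, hT, hTC⟩ := h C ⊤ ((φ ∘ₗ C.subtype).codRestrict ⊤ fun _ => Submodule.mem_top)
    (fun c => by simpa [hG.wt_eq] using hφ c c.2)
  exact ⟨T, hG.mem_linIsom_iff.1 hT, fun c hc => hTC ⟨c, hc⟩⟩

end Finite

variable {G}

/-- A set of vertices that is a union of strongly connected components inherits them. -/
theorem proj_inducedOn_eq_iff {Y : Set G.RedVert} {u v : G.proj ⁻¹' Y} :
    (G.inducedOn (G.proj ⁻¹' Y)).proj u = (G.inducedOn (G.proj ⁻¹' Y)).proj v ↔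
      G.proj u = G.proj v := by
  rw [proj_eq_iff, proj_eq_iff]
  have hdown : ∀ {u v : G.proj ⁻¹' Y}, (G.inducedOn (G.proj ⁻¹' Y)).Dominates u v →
      G.Dominates u v := fun h => Relation.ReflTransGen.lift Subtype.val (fun _ _ h => h) _ _ h
  -- Every vertex on a path from `u` to a vertex that leads back to `u` lies in the component of
  -- `u`, so the path stays inside the induced graph.
  have hup : ∀ (u : G.proj ⁻¹' Y) (w : V), G.Dominates u w → G.Dominates w u →
      ∃ hw : w ∈ G.proj ⁻¹' Y, (G.inducedOn (G.proj ⁻¹' Y)).Dominates u ⟨w, hw⟩ := by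
    intro u w huw
    induction huw with
    | refl => exact fun _ => ⟨u.2, .refl⟩
    | @tail b c hub hbc ih =>
      intro hcu
      obtain ⟨hb, hdom⟩ := ih (Relation.ReflTransGen.head hbc hcu)
      have hc : c ∈ G.proj ⁻¹' Y := by
        have : G.proj c = G.proj u := G.proj_eq_iff.2 ⟨hcu, hub.tail hbc⟩
        rw [Set.mem_preimage, this]
        exact u.2
      exact ⟨hc, hdom.tail hbc⟩
  exact ⟨fun h => ⟨hdown h.1, hdown h.2⟩,
    fun h => ⟨(hup u v h.1 h.2).2, (hup v u h.2 h.1).2⟩⟩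

theorem encard_redWeight_inducedOn (Y : Set G.RedVert) (k : ℕ) :
    {a | (G.inducedOn (G.proj ⁻¹' Y)).redWeight a = k}.encard =
      {a | a ∈ Y ∧ G.redWeight a = k}.encard := by
  set H := G.inducedOn (G.proj ⁻¹' Y) with hH
  let f : H.RedVert → G.RedVert := Quotient.lift (fun u : G.proj ⁻¹' Y => G.proj u)
    fun u v h => proj_inducedOn_eq_iff.1 (Quotient.sound h)
  have hf : ∀ u, f (H.proj u) = G.proj u := fun u => rfl
  have hinj : Function.Injective f := by
    intro a b h
    obtain ⟨u, rfl⟩ := H.proj_surjective a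
    obtain ⟨v, rfl⟩ := H.proj_surjective b
    exact proj_inducedOn_eq_iff.2 h
  have hweight : ∀ u, H.redWeight (H.proj u) = G.redWeight (G.proj u) := by
    intro u
    rw [redWeight, redWeight, ← Set.ncard_image_of_injective _ Subtype.val_injective]
    congr 1
    ext v
    constructor
    · rintro ⟨v, hv, rfl⟩
      exact proj_inducedOn_eq_iff.1 hv
    · intro hv
      have hv : G.proj v = G.proj u := hv
      have hvY : v ∈ G.proj ⁻¹' Y := by
        rw [Set.mem_preimage, hv]
        exact u.2
      exact ⟨⟨v, hvY⟩, proj_inducedOn_eq_iff.2 hv, rfl⟩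
  rw [← hinj.encard_image]
  congr 1
  ext a
  constructor
  · rintro ⟨b, hb, rfl⟩
    obtain ⟨u, rfl⟩ := H.proj_surjective b
    exact ⟨u.2, (hweight u).symm.trans hb⟩
  · rintro ⟨ha, hk⟩
    obtain ⟨u, rfl⟩ := G.proj_surjective a
    exact ⟨H.proj ⟨u, ha⟩, (hweight ⟨u, ha⟩).trans hk, rfl⟩

theorem conditionOmega_level_iff [Finite V] {i : ℕ} :
    (G.inducedOn (G.level (i + 1))).ConditionOmega ↔
      ∀ k, 1 < k → {a | G.depth a = i ∧ (G.proj ⁻¹' {a}).ncard = k}.encard ≤ 2 := by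
  refine forall₂_congr fun k _ => ?_
  rw [level, encard_redWeight_inducedOn]
  simp only [mem_redLevel_iff, Nat.add_right_cancel_iff]
  rfl

theorem UDP.ncard_inter_eq [Finite V] (hU : G.UDP) (i : ℕ) (S S' : Set G.RedVert)
    (hS : ∀ a ∈ S, G.depth a = i) (hS' : ∀ a ∈ S', G.depth a = i)
    (h : (G.proj ⁻¹' S).ncard = (G.proj ⁻¹' S').ncard) (k : ℕ) :
    (S ∩ {a | (G.proj ⁻¹' {a}).ncard = k}).ncard =
      (S' ∩ {a | (G.proj ⁻¹' {a}).ncard = k}).ncard := by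
  have hf := Set.toFinite S
  have hf' := Set.toFinite S'
  obtain ⟨g, hg⟩ := hU (i + 1) hf.toFinset hf'.toFinset
    (fun a ha => G.mem_redLevel_iff.2 (by rw [hS a (by simpa using ha)]))
    (fun a ha => G.mem_redLevel_iff.2 (by rw [hS' a (by simpa using ha)]))
    (by
      change ∑ a ∈ _, (G.proj ⁻¹' {a}).ncard = ∑ a ∈ _, (G.proj ⁻¹' {a}).ncard
      rw [LeveledBlocks.sum_ncard_fiber, LeveledBlocks.sum_ncard_fiber, hf.coe_toFinset,
        hf'.coe_toFinset, h])
  refine Set.ncard_congr (fun a ha => (g ⟨a, hf.mem_toFinset.2 ha.1⟩ : G.RedVert)) ?_ ?_ ?_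
  · exact fun a ha => ⟨hf'.mem_toFinset.1 (g _).2,
      (hg ⟨a, hf.mem_toFinset.2 ha.1⟩).symm.trans ha.2⟩
  · intro a b ha hb hab
    exact congrArg Subtype.val (g.injective (Subtype.ext hab))
  · rintro b ⟨hb, hbk⟩
    obtain ⟨⟨a, ha⟩, hab⟩ := g.surjective ⟨b, hf'.mem_toFinset.2 hb⟩
    refine ⟨a, ⟨hf.mem_toFinset.1 ha, ?_⟩, congrArg Subtype.val hab⟩
    have := hg ⟨a, ha⟩
    rw [hab] at this
    exact this.trans hbk

theorem redWeight_pos [Finite V] (a : G.RedVert) : 0 < G.redWeight a := by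
  obtain ⟨v, rfl⟩ := G.proj_surjective a
  exact (Set.ncard_pos (Set.toFinite _)).2 ⟨v, rfl⟩

theorem IsHierarchical.udp_of_macWilliamsExtension [Finite V] (hG : G.IsHierarchical)
    {F : Type*} [Field F] (hF : ∀ r : F, r = 0 ∨ r = 1) (h : G.MacWilliamsExtension F) :
    G.UDP := by
  intro i S S' hS hS' hsum
  -- An empty `S` gives only the zero word; there, positivity of the weights forces `S'` to be
  -- empty.
  rcases S.eq_empty_or_nonempty with rfl | ⟨a, ha⟩
  · obtain rfl : S' = ∅ := by
      refine Finset.eq_empty_of_forall_notMem fun b hb => ?_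
      rw [Finset.sum_empty, eq_comm, Finset.sum_eq_zero_iff] at hsum
      exact (redWeight_pos b).ne' (hsum b hb)
    exact ⟨Equiv.refl _, fun _ => rfl⟩
  · obtain ⟨j, rfl⟩ : ∃ j, i = j + 1 := ⟨_, (G.mem_redLevel_iff.1 (hS ha)).symm⟩
    exact (hG.hasExtension h).exists_equiv hF G.proj_surjective (i := j) (S := (S : Set G.RedVert))
      (S' := (S' : Set G.RedVert)) (fun b hb => Nat.succ_injective (G.mem_redLevel_iff.1 (hS hb)))
      (fun b hb => Nat.succ_injective (G.mem_redLevel_iff.1 (hS' hb))) ⟨a, ha⟩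
      (by rw [← LeveledBlocks.sum_ncard_fiber, ← LeveledBlocks.sum_ncard_fiber]; exact hsum)

theorem IsHierarchical.macWilliamsExtension_of_udp [Finite V] (hG : G.IsHierarchical)
    {F : Type*} [Field F] (hF : ∀ r : F, r = 0 ∨ r = 1) (hU : G.UDP)
    (hΩ : ∀ i k, 1 < k → {a | G.depth a = i ∧ (G.proj ⁻¹' {a}).ncard = k}.encard ≤ 2) :
    G.MacWilliamsExtension F := by
  intro C C' t ht
  obtain ⟨T, hT, hTt⟩ := LeveledBlocks.exists_extension (C'.subtype ∘ₗ t) hF G.proj_surjective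
    hU.ncard_inter_eq hΩ (fun c => by simpa [hG.wt_eq] using ht c)
  -- Only the zero word has weight zero, so a weight-preserving linear map is injective, hence
  -- bijective in finite dimension.
  have hinj : Function.Injective T := by
    rw [injective_iff_map_eq_zero]
    intro x hx
    rw [← LeveledBlocks.blockWt_eq_zero_iff (p := G.proj) (l := G.depth), ← hT, hx,
      LeveledBlocks.blockWt_eq_zero_iff]
  exact ⟨LinearEquiv.ofInjectiveEndo T hinj, hG.mem_linIsom_iff.2 hT, hTt⟩

end Digraph

theorem mainTheorem11 {V : Type*} [Finite V] (G : Digraph V) (hG : G.IsHierarchical) :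
    G.MacWilliamsExtension (ZMod 2) ↔
      G.UDP ∧ ∀ i : ℕ, 1 ≤ i → (i : ℕ∞) ≤ G.numLevels →
        (G.inducedOn (G.level i)).ConditionOmega := by
  have hF : ∀ r : ZMod 2, r = 0 ∨ r = 1 := by decide
  constructor
  · intro h
    refine ⟨hG.udp_of_macWilliamsExtension hF h, fun i hi _ => ?_⟩
    obtain ⟨j, rfl⟩ := Nat.exists_eq_add_of_le' hi
    exact Digraph.conditionOmega_level_iff.2 fun k hk =>
      (hG.hasExtension h).encard_le_two hF G.proj_surjective j hk
  · rintro ⟨hU, hΩ⟩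
    refine hG.macWilliamsExtension_of_udp hF hU fun i k hk => ?_
    -- Ω is assumed only for levels up to `h_G`. A depth `i` that occurs is the level `i + 1` of
    -- some component; any other depth has no blocks.
    by_cases hi : ∃ a, G.depth a = i
    · obtain ⟨a, rfl⟩ := hi
      refine Digraph.conditionOmega_level_iff.1 (hΩ (G.depth a + 1) (by omega) ?_) k hk
      refine le_trans (le_of_eq ?_) (le_iSup G.redHeight a)
      rw [Digraph.redHeight, ← G.coe_depth]
      rfl
    · have : {a | G.depth a = i ∧ (G.proj ⁻¹' {a}).ncard = k} = ∅ :=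
        Set.eq_empty_of_forall_notMem fun a ha => hi ⟨a, ha.1⟩
      rw [this]
      simp
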